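/- Let $n\ge 1$, write $\boldsymbol t=(t_1,\dots,t_n)$, and let $f=\sum_{\boldsymbol i\in\mathbb N^n} a(\boldsymbol i)\,\boldsymbol t^{\boldsymbol i}\in\mathbb Z[[\boldsymbol t]]$ be a power series that is algebraic over $\mathbb Q(\boldsymbol t)$. Let $E(\boldsymbol t,y)\in\mathbb Q[\boldsymbol t,y]$ be a minimal polynomial of $f$, i.e. a nonzero polynomial with $E(\boldsymbol t,f)=0$ that divides every $F\in\mathbb Q[\boldsymbol t,y]$ with $F(\boldsymbol t,f)=0$ (such an $E$ exists and is unique up to a nonzero constant factor in $\mathbb Q$). Let $d$ be the degree of $E$ in $y$ (the degree of $f$), let $h$ be the total degree of $E$ in $\boldsymbol t$ (the total height of $f$), and for $1\le i\le n$ let $h_i$ be the degree of $E$ in $t_i$ (the partial heights of $f$). Set $$N=(d+1)\cdot\min\left\{\prod_{i=1}^n(h_i+1)-\prod_{i=1}^n h_i,\ \binom{n+h}{n}-\binom{h}{n}\right\}.$$ For a prime number $p$, let $\Delta(f)_{|p}=\sum_{i\ge 0}\bigl(a(i,\dots,i)\bmod p\bigr)\,t^i\in\mathbb F_p[[t]]$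 be the reduction modulo $p$ of the diagonal of $f$. Then, for every prime number $p$, there are an integer $0\le M\le N$ and $c_0,\dots,c_M\in\mathbb F_p(t)$ with $c_M\neq0$ such that the linearized polynomial $P(X)=c_0X+c_1X^p+\cdots+c_MX^{p^M}$ (of $p$-degree $M$) satisfies $P(\Delta(f)_{|p})=0$. In particular, $\Delta(f)_{|p}$ is algebraic over $\mathbb F_p(t)$, of degree at most $p^N-1$. -/

import Mathlib

open scoped RatFunc

noncomputable section

namespace DiagModP

open Polynomial

/-- `E ∈ k[t₁,…,tₙ][y]` is a minimal polynomial of the power series `f` over the field `k`: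
it is a nonzero polynomial with `E(t, f) = 0`, and it is minimal for divisibility among the
polynomials of `k[t, y]` that annihilate `f`. -/
structure IsMinimalPolynomial {n : ℕ} {k : Type*} [Field k] (f : MvPowerSeries (Fin n) k)
    (E : Polynomial (MvPolynomial (Fin n) k)) : Prop where
  ne_zero : E ≠ 0
  aeval_eq_zero : aeval f E = 0
  dvd : ∀ F : Polynomial (MvPolynomial (Fin n) k), aeval f F = 0 → E ∣ F

/-- Over a unique factorization domain `R`, the polynomials that annihilate an algebraic element
of a domain containing `R` are the multiples of one of them. -/
theorem exists_generator_annihilator {R S : Type*} [CommRing R] [IsDomain R]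
    [UniqueFactorizationMonoid R] [CommRing S] [IsDomain S] [Algebra R S]
    (K L : Type*) [Field K] [Algebra R K] [IsFractionRing R K]
    [Field L] [Algebra S L] [IsFractionRing S L]
    (hinj : Function.Injective (algebraMap R S)) {f : S} (hf : IsAlgebraic R f) :
    ∃ E : R[X], E ≠ 0 ∧ aeval f E = 0 ∧ ∀ F : R[X], aeval f F = 0 → E ∣ F := by
  classical
  have hφ : Function.Injective ((algebraMap S L).comp (algebraMap R S)) :=
    (IsFractionRing.injective S L).comp hinj
  obtain ⟨ψ, hψ⟩ : ∃ ψ : K →+* L,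
      ψ.comp (algebraMap R K) =
        (algebraMap S L).comp (algebraMap R S) :=
    ⟨IsFractionRing.lift hφ, RingHom.ext fun r => IsFractionRing.lift_algebraMap hφ r⟩
  have hev : ∀ F : R[X], aeval f F = 0 → (F.map (algebraMap R K)).eval₂ ψ
      (algebraMap S L f) = 0 := by
    intro F hF
    rw [eval₂_map, hψ, ← hom_eval₂, ← aeval_def, hF, map_zero]
  have hP : (RingHom.ker (aeval (R := R) f)).IsPrime := RingHom.ker_isPrime _
  have hbot : RingHom.ker (aeval (R := R) f) ≠ ⊥ := by
    obtain ⟨F, hF0, hF⟩ := hf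
    intro h
    have : F ∈ RingHom.ker (aeval (R := R) f) := hF
    rw [h] at this
    exact hF0 this
  obtain ⟨E, hE, hEp⟩ := hP.exists_mem_prime_of_ne_bot hbot
  have hE0 : aeval f E = 0 := hE
  have hdeg : E.natDegree ≠ 0 := by
    intro h
    obtain ⟨c, hc⟩ := natDegree_eq_zero.mp h
    rw [← hc, aeval_C] at hE0
    have : c = 0 := hinj (by rw [hE0, map_zero])
    exact hEp.ne_zero (by rw [← hc, this, C_0])
  have hprim : E.IsPrimitive := hEp.irreducible.isPrimitive hdeg
  let _ : NormalizedGCDMonoid R := Nonempty.some inferInstance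
  have hirr : Irreducible (E.map (algebraMap R K)) :=
    hprim.irreducible_iff_irreducible_map_fraction_map.mp hEp.irreducible
  refine ⟨E, hEp.ne_zero, hE0, fun F hF => ?_⟩
  refine hprim.dvd_of_fraction_map_dvd_fraction_map (K := K) ?_
  by_contra hnd
  obtain ⟨a, b, hab⟩ := hirr.coprime_iff_not_dvd.mpr hnd
  have := congrArg (eval₂ ψ (algebraMap S L f)) hab
  rw [eval₂_add, eval₂_mul, eval₂_mul, hev E hE0, hev F hF] at this
  simp at this

/-- Every algebraic power series has a minimal polynomial in `k[t, y]`. -/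
theorem exists_isMinimalPolynomial {n : ℕ} {k : Type*} [Field k] {f : MvPowerSeries (Fin n) k}
    (hf : IsAlgebraic (MvPolynomial (Fin n) k) f) :
    ∃ E : Polynomial (MvPolynomial (Fin n) k), IsMinimalPolynomial f E := by
  have hinj : Function.Injective
      (algebraMap (MvPolynomial (Fin n) k) (MvPowerSeries (Fin n) k)) := by
    intro a b hab
    rw [MvPowerSeries.algebraMap_apply', MvPowerSeries.algebraMap_apply'] at hab
    have : (MvPowerSeries.map (σ := Fin n) (algebraMap k k)) = RingHom.id _ :=
      MvPowerSeries.map_id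
    rw [this] at hab
    exact MvPolynomial.coe_injective _ _ hab
  have : IsDomain (MvPowerSeries (Fin n) k) := NoZeroDivisors.to_isDomain _
  obtain ⟨E, h1, h2, h3⟩ := exists_generator_annihilator
    (FractionRing (MvPolynomial (Fin n) k)) (FractionRing (MvPowerSeries (Fin n) k)) hinj hf
  exact ⟨E, h1, h2, h3⟩

open Classical in
/-- The minimal polynomial of an algebraic power series, unique up to a nonzero constant of `k`
(with the default value `0` when `f` is not algebraic). -/
def minimalPolynomial {n : ℕ} {k : Type*} [Field k] (f : MvPowerSeries (Fin n) k) :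
    Polynomial (MvPolynomial (Fin n) k) :=
  if h : ∃ E, IsMinimalPolynomial f E then h.choose else 0

theorem isMinimalPolynomial_minimalPolynomial {n : ℕ} {k : Type*} [Field k]
    {f : MvPowerSeries (Fin n) k} (hf : IsAlgebraic (MvPolynomial (Fin n) k) f) :
    IsMinimalPolynomial f (minimalPolynomial f) := by
  have h := exists_isMinimalPolynomial hf
  rw [minimalPolynomial, dif_pos h]
  exact h.choose_spec

/-- The degree of an algebraic power series: the degree in `y` of its minimal polynomial. -/
def degree {n : ℕ} {k : Type*} [Field k] (f : MvPowerSeries (Fin n) k) : ℕ :=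
  (minimalPolynomial f).natDegree

/-- The total height of an algebraic power series: the total degree in `t = (t₁,…,tₙ)` of its
minimal polynomial `E(t, y)`. -/
def totalHeight {n : ℕ} {k : Type*} [Field k] (f : MvPowerSeries (Fin n) k) : ℕ :=
  (minimalPolynomial f).support.sup fun j => ((minimalPolynomial f).coeff j).totalDegree

/-- The partial heights of an algebraic power series: `hᵢ` is the degree in `tᵢ` of its minimal
polynomial `E(t, y)`. -/
def partialHeight {n : ℕ} {k : Type*} [Field k] (f : MvPowerSeries (Fin n) k) (i : Fin n) : ℕ :=
  (minimalPolynomial f).support.sup fun j => ((minimalPolynomial f).coeff j).degreeOf i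

/-- `(d+1) · min {∏ (hᵢ+1) - ∏ hᵢ, C(n+h,n) - C(h,n)}`. Both differences are differences of natural
numbers `a - b` with `b ≤ a`. -/
def bound {n : ℕ} (d h : ℕ) (hs : Fin n → ℕ) : ℕ :=
  (d + 1) * min (∏ i, (hs i + 1) - ∏ i, hs i) ((n + h).choose n - h.choose n)

/-- The diagonal `∑ a(i,…,i) tⁱ` of the power series `∑ a(i₁,…,iₙ) t₁^{i₁}⋯tₙ^{iₙ}`. -/
def diagonal {n : ℕ} {R : Type*} [Semiring R] (f : MvPowerSeries (Fin n) R) : PowerSeries R :=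
  PowerSeries.mk fun i => MvPowerSeries.coeff (Finsupp.equivFunOnFinite.symm fun _ => i) f

/-- `P` is a linearized polynomial `c₀ X + c₁ X^p + ⋯ + c_M X^(p^M)` of `p`-degree `M`
over `K`, with `c_M ≠ 0`. -/
def IsLinearized {K : Type*} [Field K] (p M : ℕ) (P : Polynomial K) : Prop :=
  ∃ c : ℕ → K, c M ≠ 0 ∧ P = ∑ i ∈ Finset.range (M + 1), C (c i) * X ^ p ^ i

end DiagModP

end

/-! ### Linearized polynomials from finite-dimensional spaces -/

namespace DiagModP

/-! Clearing denominators and dividing out the power of `p` turns the minimal polynomial into a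
nonzero annihilator of `f` mod `p` with no new exponents (`exists_annihilator_mod_prime`). It can be
replaced by some `E`, within the same degree bounds, for which `D = E_y(t, f)` is nonzero
(`exists_simple_annihilator`). Let `G` be the set of series `g` with `D g = P(t, f)` for some `P`
within these bounds, and let `W` be the span over `𝔽ₚ(T)` of the diagonals of `G`.

The set `G` contains `f`, through `P = y E_y`. It is stable under Cartier sections: `D` times a
section of `g` is the section of `D^p g = D^(p-1) P(t, f)`, and Wilson's theorem identifies `D^(p-1)
P(t, f)` with `-∂_y^(p-1)(P E^(p-1))` at `y = f`, so the new numerator is a section of `P E^(p-1)`,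
whose degrees are at most `p` times the bounds (`pderiv_mul_cartierSection`). Since the diagonal of
`t^r h^p` is a polynomial times the `p`-th power of the diagonal of `h`, it follows that `W` lies in
the span of its own `p`-th powers.

The diagonal turns multiplication by `t₁⋯tₙ` into multiplication by `T`. Hence only the monomials
`t^v y^j` with some `vᵢ = 0` count, and `dim W ≤ N` (`finrank_span_image_comap_le`,
`evalSeries_mem_span_monomialFamily`). Linear algebra then makes `x, x^p, …, x^(p^N)` dependent for
every `x` in `W` (`exists_isLinearized_of_le_span_pow`). -/

theorem pow_mem_span_image_pow {K L : Type*} [Field K] [Field L] [Algebra K L] (p : ℕ)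
    [ExpChar L p] (m : ℕ) {s : Set L} {w : L} (hw : w ∈ Submodule.span K s) :
    w ^ p ^ m ∈ Submodule.span K ((fun z => z ^ p ^ m) '' s) := by
  induction hw using Submodule.span_induction with
  | mem x hx => exact Submodule.subset_span ⟨x, hx, rfl⟩
  | zero => rw [zero_pow (pow_ne_zero _ (expChar_ne_zero L p))]; exact zero_mem _
  | add x y _ _ hx hy => rw [add_pow_expChar_pow]; exact add_mem hx hy
  | smul c x _ hx => rw [smul_pow]; exact Submodule.smul_mem _ _ hx

open Polynomial in
-- Let `V m` be the span of the `p^m`-th powers of `W`. Raising the inclusion `hW` to the power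
-- `p^m` gives `V m ≤ V (m + 1)`, so the `N + 1` elements `x^(p^i)`, `i ≤ N`, all lie in `V N`. This
-- space is spanned by the `p^N`-th powers of a basis of `W`, at most `N` elements.
theorem exists_isLinearized_of_le_span_pow {K L : Type*} [Field K] [Field L] [Algebra K L] (p : ℕ)
    [ExpChar L p] (W : Submodule K L) [FiniteDimensional K W] {N : ℕ}
    (hN : Module.finrank K W ≤ N) (hW : W ≤ Submodule.span K ((fun z => z ^ p) '' (W : Set L)))
    {x : L} (hx : x ∈ W) :
    ∃ M ≤ N, ∃ P : K[X], DiagModP.IsLinearized p M P ∧ aeval x P = 0 := by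
  classical
  let V : ℕ → Submodule K L := fun m => Submodule.span K ((fun z => z ^ p ^ m) '' (W : Set L))
  have hmono : Monotone V := by
    refine monotone_nat_of_le_succ fun m => Submodule.span_le.mpr ?_
    rintro _ ⟨w, hw, rfl⟩
    have h := pow_mem_span_image_pow p m (hW hw)
    rw [Set.image_image] at h
    simpa only [V, pow_succ', pow_mul, SetLike.mem_coe] using h
  let b := Module.finBasis K W
  let s : Finset L := Finset.univ.image fun i => (b i : L) ^ p ^ N
  have hs : V N ≤ Submodule.span K (s : Set L) := by
    refine Submodule.span_le.mpr ?_
    rintro _ ⟨w, hw, rfl⟩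
    have hw' : w ∈ Submodule.span K (Set.range fun i => (b i : L)) := by
      have := b.mem_span ⟨w, hw⟩
      have h2 := Submodule.mem_map_of_mem (f := W.subtype) this
      rw [Submodule.map_span, ← Set.range_comp] at h2
      exact h2
    have h := pow_mem_span_image_pow p N hw'
    rw [← Set.range_comp] at h
    simpa [s, Function.comp_def] using h
  have hcard : s.card ≤ N := (Finset.card_image_le.trans (by simp)).trans hN
  have hxV : ∀ i : Fin (N + 1), x ^ p ^ (i : ℕ) ∈ Submodule.span K (s : Set L) := fun i =>
    hs (hmono (Nat.le_of_lt_succ i.2) (Submodule.subset_span ⟨x, hx, rfl⟩))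
  have hdep : ¬ LinearIndependent K fun i : Fin (N + 1) =>
      (⟨_, hxV i⟩ : Submodule.span K (s : Set L)) := by
    intro h
    have h1 := h.fintype_card_le_finrank
    have h2 := finrank_span_finset_le_card (R := K) s
    rw [Fintype.card_fin] at h1
    have : Module.finrank K (Submodule.span K (s : Set L)) ≤ s.card := h2
    omega
  rw [Fintype.not_linearIndependent_iff] at hdep
  obtain ⟨g, hg, i0, hi0⟩ := hdep
  have hg' : ∑ i : Fin (N + 1), g i • x ^ p ^ (i : ℕ) = 0 := by
    have := congrArg (Submodule.span K (s : Set L)).subtype hg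
    simpa using this
  let c : ℕ → K := fun i => if h : i < N + 1 then g ⟨i, h⟩ else 0
  have hcg : ∀ i : Fin (N + 1), c i = g i := fun i => by simp only [c, dif_pos i.2, Fin.eta]
  -- The last index with a nonzero coefficient in the dependence relation, so that the leading
  -- coefficient does not vanish.
  let M := Nat.findGreatest (fun i => c i ≠ 0) N
  have hcM : c M ≠ 0 := Nat.findGreatest_spec (P := fun i => c i ≠ 0) (Nat.le_of_lt_succ i0.2)
    (by rwa [hcg])
  have hMN : M ≤ N := Nat.findGreatest_le N
  refine ⟨M, hMN, _, ⟨c, hcM, rfl⟩, ?_⟩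
  have hsum : ∑ i ∈ Finset.range (N + 1), c i • x ^ p ^ i = 0 := by
    rw [Finset.sum_range, ← hg']
    exact Finset.sum_congr rfl fun i _ => by rw [hcg]
  rw [map_sum, ← hsum]
  refine (Finset.sum_subset (Finset.range_mono (by omega)) fun i hi hi' => ?_).trans
    (Finset.sum_congr rfl fun i _ => ?_)
  · have : c i = 0 := by
      by_contra h
      rw [Finset.mem_range] at hi hi'
      exact hi' (Nat.lt_succ_of_le (Nat.le_findGreatest (by omega) h))
    simp [this]
  · simp [Algebra.smul_def]

open Polynomial in
-- A linearized polynomial is divisible by `X`; for `x ≠ 0` the quotient still kills `x`, which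
-- saves one in the degree. For `x = 0` the minimal polynomial is `X`, and `N ≠ 0` is what makes `1
-- ≤ p^N - 1`.
theorem isAlgebraic_and_natDegree_minpoly_le {K L : Type*} [Field K] [Field L] [Algebra K L]
    {p M N : ℕ} (hp : p.Prime) (hN : N ≠ 0) (hMN : M ≤ N) {x : L} {P : K[X]}
    (hP : DiagModP.IsLinearized p M P) (hx : aeval x P = 0) :
    IsAlgebraic K x ∧ (minpoly K x).natDegree ≤ p ^ N - 1 := by
  have hpN : 1 ≤ p ^ N - 1 := by
    have := Nat.pow_le_pow_left hp.two_le N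
    have h2 : 2 ^ 1 ≤ 2 ^ N := Nat.pow_le_pow_right (by norm_num) (by omega)
    omega
  by_cases hx0 : x = 0
  · subst hx0
    exact ⟨isAlgebraic_zero, by rw [minpoly.zero, natDegree_X]; exact hpN⟩
  obtain ⟨c, hcM, rfl⟩ := hP
  have hpos : ∀ i, p ^ i ≠ 0 := fun i => pow_ne_zero _ hp.ne_zero
  let Q : K[X] := ∑ i ∈ Finset.range (M + 1), C (c i) * X ^ (p ^ i - 1)
  have hQ : (∑ i ∈ Finset.range (M + 1), C (c i) * X ^ p ^ i) = Q * X := by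
    rw [Finset.sum_mul]
    refine Finset.sum_congr rfl fun i _ => ?_
    rw [mul_assoc, pow_sub_one_mul (hpos i)]
  have hQx : aeval x Q = 0 := by
    rw [hQ, map_mul, aeval_X] at hx
    exact (mul_eq_zero.mp hx).resolve_right hx0
  have hQ0 : Q ≠ 0 := by
    intro h
    have h1 := congrArg (fun q => coeff q (p ^ M - 1)) h
    simp only [Q, finsetSum_coeff, coeff_C_mul, coeff_X_pow, coeff_zero] at h1
    rw [Finset.sum_eq_single M] at h1
    · exact hcM (by simpa using h1)
    · intro i _ hi
      have hne : p ^ M ≠ p ^ i := fun h => hi (Nat.pow_right_injective hp.two_le h).symm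
      have := Nat.pos_of_ne_zero (hpos M)
      have := Nat.pos_of_ne_zero (hpos i)
      rw [if_neg (by omega), mul_zero]
    · simp
  refine ⟨⟨Q, hQ0, hQx⟩, (natDegree_le_of_dvd (minpoly.dvd K x hQx) hQ0).trans ?_⟩
  refine natDegree_sum_le_of_forall_le _ _ fun i hi => (natDegree_C_mul_X_pow_le _ _).trans ?_
  have : p ^ i ≤ p ^ N := Nat.pow_le_pow_right hp.pos (by rw [Finset.mem_range] at hi; omega)
  omega

/-- Multiplication by `D` embeds the set of `g` into the span of `B`, and `φ` does not raise the
rank. Passing to the fraction field costs nothing, since elements independent over `K` are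
independent over `R`. -/
theorem finrank_span_image_comap_le {R K L S : Type} [CommRing R] [IsDomain R] [Field K] [Field L]
    [Algebra R K] [IsFractionRing R K] [Algebra K L] [CommRing S] [IsDomain S] [Algebra R S]
    [Algebra R L] [IsScalarTower R K L]
    (φ : S →ₗ[R] L) {D : S} (hD : D ≠ 0) (B : Finset S) :
    Module.Finite K (Submodule.span K (φ '' {g | D * g ∈ Submodule.span R (B : Set S)})) ∧
    Module.finrank K (Submodule.span K (φ '' {g | D * g ∈ Submodule.span R (B : Set S)})) ≤
      B.card := by
  let G := (Submodule.span R (B : Set S)).comap (LinearMap.mulLeft R D)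
  have hG : Module.rank R G ≤ B.card := by
    have h1 : Module.rank R G ≤ Module.rank R (Submodule.span R (B : Set S)) := by
      refine LinearMap.rank_le_of_injective
        ((LinearMap.mulLeft R D).restrict (p := G) (q := Submodule.span R (B : Set S))
          fun g hg => hg) ?_
      intro a b hab
      have := congrArg Subtype.val hab
      exact Subtype.ext (mul_left_cancel₀ hD this)
    exact h1.trans (rank_span_finset_le B)
  have hφG : Module.rank R (G.map φ) ≤ B.card := (rank_map_le φ G).trans hG
  have hset : φ '' {g | D * g ∈ Submodule.span R (B : Set S)} = (G.map φ : Set L) := rfl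
  rw [hset]
  have hrank : Module.rank K (Submodule.span K (G.map φ : Set L)) ≤ B.card := by
    obtain ⟨b, hbs, hbspan, hbi⟩ := exists_linearIndependent K (G.map φ : Set L)
    rw [← hbspan, rank_span_set hbi]
    have hbR : LinearIndependent R (fun z : b => (⟨z, hbs z.2⟩ : G.map φ)) := by
      have h1 : LinearIndependent R (fun z : b => (z : L)) :=
        hbi.restrict_scalars (R := R) (K := K) (by
          intro a c hac
          refine IsFractionRing.injective R K ?_
          simpa [Algebra.smul_def] using hac)
      exact LinearIndependent.of_comp (G.map φ).subtype h1
    exact hbR.cardinal_le_rank.trans hφG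
  refine ⟨?_, Module.finrank_le_of_rank_le hrank⟩
  exact Module.rank_lt_aleph0_iff.mp (hrank.trans_lt Cardinal.natCast_lt_aleph0)

end DiagModP

/-! ### Base-`p` digits and Cartier sections of power series -/

noncomputable section

/-- The exponent whose entries are the base-`p` digits `r i < p`. -/
def digitExponent {σ : Type*} [Finite σ] {p : ℕ} (r : σ → Fin p) : σ →₀ ℕ :=
  Finsupp.equivFunOnFinite.symm fun i => (r i : ℕ)

@[simp]
theorem digitExponent_apply {σ : Type*} [Finite σ] {p : ℕ} (r : σ → Fin p) (i : σ) :
    digitExponent r i = r i := rfl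

/-- The entrywise residue of an exponent modulo `p`. -/
def digitOf {σ : Type*} (p : ℕ) [NeZero p] (u : σ →₀ ℕ) : σ → Fin p := fun i => Fin.ofNat p (u i)

/-- The entrywise quotient of an exponent by `p`. -/
def quotientExponent {σ : Type*} (p : ℕ) (u : σ →₀ ℕ) : σ →₀ ℕ :=
  u.mapRange (fun m => m / p) (Nat.zero_div p)

theorem digitExponent_digitOf_add {σ : Type*} [Finite σ] (p : ℕ) [NeZero p] (u : σ →₀ ℕ) :
    digitExponent (digitOf p u) + p • quotientExponent p u = u := by
  ext i
  simp [digitOf, quotientExponent, Nat.mod_add_div]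

namespace MvPowerSeries

variable {σ : Type*} {p : ℕ} [Fact p.Prime]

theorem pow_prime_eq_expand (h : MvPowerSeries σ (ZMod p)) :
    h ^ p = expand p (Fact.out : p.Prime).ne_zero h := by
  have := map_frobenius_expand (σ := σ) (R := ZMod p) p (Fact.out : p.Prime).ne_zero (f := h)
  rw [← this, ZMod.frobenius_zmod, map_id]
  rfl

/-- Over `𝔽ₚ` the `p`-th power only multiplies exponents by `p`, so `X^r h^p` is supported on
exponents congruent to `r`. Digits being unique, sections of a sum of such terms can be read off. -/
theorem coeff_monomial_digitExponent_mul_pow [Fintype σ] (r r' : σ → Fin p)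
    (v : σ →₀ ℕ) (h : MvPowerSeries σ (ZMod p)) :
    coeff (digitExponent r' + p • v) (monomial (digitExponent r) 1 * h ^ p) =
      if r' = r then coeff v h else 0 := by
  classical
  rw [coeff_monomial_mul, one_mul, pow_prime_eq_expand]
  split_ifs with h1 h2 h2
  · rw [h2, add_tsub_cancel_left, coeff_expand_smul]
  · obtain ⟨i, hi⟩ := Function.ne_iff.mp h2
    refine coeff_expand_of_not_dvd p _ h (i := i) fun hd => hi ?_
    have hle : (r i : ℕ) ≤ r' i + p * v i := by simpa using h1 i
    have hd' : p ∣ r' i + p * v i - r i := by simpa using hd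
    have hmod := (Nat.modEq_iff_dvd' hle).mpr hd'
    have h3 : (r i : ℕ) % p = (r' i : ℕ) % p := by simpa [Nat.ModEq] using hmod
    rw [Nat.mod_eq_of_lt (r i).2, Nat.mod_eq_of_lt (r' i).2] at h3
    exact Fin.ext h3.symm
  · subst h2
    exact absurd (le_add_of_nonneg_right zero_le) h1
  · rfl

/-- The Cartier section `∑ a(r + p v) X^v` of the series `∑ a(u) X^u`. -/
def cartierSection [Finite σ] (g : MvPowerSeries σ (ZMod p)) (r : σ → Fin p) :
    MvPowerSeries σ (ZMod p) :=
  fun v => coeff (digitExponent r + p • v) g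

theorem coeff_cartierSection [Finite σ] (g : MvPowerSeries σ (ZMod p)) (r : σ → Fin p)
    (v : σ →₀ ℕ) : coeff v (cartierSection g r) = coeff (digitExponent r + p • v) g := rfl

variable [Fintype σ] [DecidableEq σ]

theorem cartierSection_sum (c : (σ → Fin p) → MvPowerSeries σ (ZMod p)) (r : σ → Fin p) :
    cartierSection (∑ r', monomial (digitExponent r') 1 * c r' ^ p) r = c r := by
  ext v
  rw [coeff_cartierSection, map_sum, Finset.sum_eq_single r]
  · rw [coeff_monomial_digitExponent_mul_pow, if_pos rfl]
  · intro r' _ hr'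
    rw [coeff_monomial_digitExponent_mul_pow, if_neg hr'.symm]
  · simp

theorem sum_cartierSection (g : MvPowerSeries σ (ZMod p)) :
    ∑ r, monomial (digitExponent r) 1 * cartierSection g r ^ p = g := by
  ext u
  rw [← digitExponent_digitOf_add p u, ← coeff_cartierSection, cartierSection_sum,
    coeff_cartierSection]

/-- Multiplying the expansion of `g` by `D^p` multiplies each section by `D`, and the expansion is
unique. -/
theorem cartierSection_pow_mul (D g : MvPowerSeries σ (ZMod p)) (r : σ → Fin p) :
    cartierSection (D ^ p * g) r = D * cartierSection g r := by
  conv_lhs => rw [← sum_cartierSection g, Finset.mul_sum]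
  rw [← cartierSection_sum (fun r' => D * cartierSection g r') r]
  congr 1
  exact Finset.sum_congr rfl fun r' _ => by rw [mul_pow]; ring

end MvPowerSeries

/-! ### The diagonal -/

namespace DiagModP

variable {n : ℕ}

/-- The diagonal as an additive map. -/
def diagonalHom (n : ℕ) (R : Type*) [Semiring R] : MvPowerSeries (Fin n) R →+ PowerSeries R where
  toFun := diagonal
  map_zero' := by ext; simp [diagonal]
  map_add' f g := by ext; simp [diagonal]

theorem diagonalHom_apply {R : Type*} [Semiring R] (f : MvPowerSeries (Fin n) R) :
    diagonalHom n R f = diagonal f := rfl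

theorem coeff_diagonal {R : Type*} [Semiring R] (f : MvPowerSeries (Fin n) R) (m : ℕ) :
    PowerSeries.coeff m (diagonal f) =
      MvPowerSeries.coeff (Finsupp.equivFunOnFinite.symm fun _ => m) f := by
  simp [diagonal]

theorem map_diagonal {R S : Type*} [Semiring R] [Semiring S] (φ : R →+* S)
    (f : MvPowerSeries (Fin n) R) :
    PowerSeries.map φ (diagonal f) = diagonal (MvPowerSeries.map φ f) := by
  ext m
  simp [coeff_diagonal]

theorem diagonal_prod_X_mul {R : Type*} [CommSemiring R] [NeZero n]
    (f : MvPowerSeries (Fin n) R) :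
    diagonal ((∏ i, MvPowerSeries.X i) * f) = PowerSeries.X * diagonal f := by
  classical
  have hT : (∏ i, MvPowerSeries.X i : MvPowerSeries (Fin n) R) =
      MvPowerSeries.monomial (Finsupp.equivFunOnFinite.symm fun _ => 1) 1 := by
    rw [MvPowerSeries.monomial_eq', Finsupp.prod_fintype _ _ (by simp)]
    simp
  ext m
  rw [coeff_diagonal, hT, MvPowerSeries.coeff_monomial_mul, one_mul]
  cases m with
  | zero =>
    rw [PowerSeries.coeff_zero_X_mul, if_neg]
    intro h
    have := h (0 : Fin n)
    simp at this
  | succ m =>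
    rw [PowerSeries.coeff_succ_X_mul, coeff_diagonal, if_pos]
    · congr 1
      congr 1
      ext i
      simp
    · intro i; simp

theorem diagonal_aeval_mul {R : Type*} [CommSemiring R] [NeZero n]
    (c : Polynomial R) (f : MvPowerSeries (Fin n) R) :
    diagonal (Polynomial.aeval (∏ i, MvPowerSeries.X i) c * f) = (c : PowerSeries R) * diagonal f := by
  induction c using Polynomial.induction_on' generalizing f with
  | add a b ha hb =>
    rw [map_add, add_mul, ← diagonalHom_apply, map_add, diagonalHom_apply, diagonalHom_apply, ha,
      hb, Polynomial.coe_add, add_mul]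
  | monomial m a =>
    induction m generalizing f with
    | zero =>
      ext j
      simp [coeff_diagonal, MvPowerSeries.algebraMap_apply,
        MvPowerSeries.coeff_C_mul]
    | succ m ih =>
      have h1 : Polynomial.monomial (m + 1) a = Polynomial.monomial m a * Polynomial.X := by
        rw [Polynomial.monomial_mul_X]
      rw [h1, map_mul, Polynomial.aeval_X, mul_assoc, ih, diagonal_prod_X_mul, Polynomial.coe_mul,
        Polynomial.coe_X, mul_assoc]

/-- The exponent `(m, …, m)` has all its residues equal. So `c` is `T^(r 0)` when `r` is constant
and `0` otherwise. -/
theorem exists_diagonal_monomial_mul_pow {p : ℕ} [Fact p.Prime] [NeZero n] (r : Fin n → Fin p) :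
    ∃ c : Polynomial (ZMod p), ∀ h : MvPowerSeries (Fin n) (ZMod p),
      diagonal (MvPowerSeries.monomial (digitExponent r) 1 * h ^ p) = (c : PowerSeries (ZMod p)) * diagonal h ^ p := by
  classical
  have hp : p ≠ 0 := (Fact.out : p.Prime).ne_zero
  have key : ∀ (h : MvPowerSeries (Fin n) (ZMod p)) m, PowerSeries.coeff m
      (diagonal (MvPowerSeries.monomial (digitExponent r) 1 * h ^ p)) =
      if (fun _ => Fin.ofNat p m) = r then PowerSeries.coeff (m / p) (diagonal h) else 0 := by
    intro h m
    have : (Finsupp.equivFunOnFinite.symm fun _ => m : Fin n →₀ ℕ) =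
        digitExponent (fun _ => Fin.ofNat p m) +
          p • (Finsupp.equivFunOnFinite.symm fun _ => m / p) := by
      ext i
      simp [Nat.mod_add_div]
    rw [coeff_diagonal, this, MvPowerSeries.coeff_monomial_digitExponent_mul_pow, coeff_diagonal]
  by_cases hr : ∀ i, r i = r 0
  · refine ⟨Polynomial.X ^ (r 0 : ℕ), fun h => ?_⟩
    ext m
    have hX : (Polynomial.X ^ (r 0 : ℕ) : Polynomial (ZMod p)).toPowerSeries =
        MvPowerSeries.monomial (digitExponent fun _ : Unit => r 0) 1 := by
      rw [Polynomial.coe_pow, Polynomial.coe_X, PowerSeries.X_pow_eq, PowerSeries.monomial]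
      congr 2
      ext
      simp
    have hm : Finsupp.single () m = digitExponent (fun _ : Unit => Fin.ofNat p m) +
        p • Finsupp.single () (m / p) := by
      ext
      simp [Nat.mod_add_div]
    -- The one-variable side is the same coefficient formula, with `Unit` as the set of variables.
    have hc := MvPowerSeries.coeff_monomial_digitExponent_mul_pow (fun _ => r 0)
      (fun _ => Fin.ofNat p m) (Finsupp.single () (m / p)) (diagonal h)
    rw [← hm] at hc
    rw [key, hX]
    refine Eq.trans ?_ hc.symm
    refine if_congr ⟨fun h => ?_, fun h => ?_⟩ rfl rfl
    · exact funext fun _ => congrFun h 0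
    · exact funext fun i => (congrFun h ()).trans (hr i).symm
  · refine ⟨0, fun h => ?_⟩
    ext m
    rw [key, if_neg]
    · simp
    · rintro rfl
      exact hr fun _ => rfl

end DiagModP


/-! ### Iterated derivations of powers -/

namespace Derivation

variable {R A : Type*} [CommRing R] [CommRing A] [Algebra R A] (δ : Derivation R A A)

/-- Modulo `E`, a term survives only if the `m` derivations fall on the `m` different factors `E`,
which happens in `m!` ways. -/
theorem exists_pow_apply_mul_pow (E : A) (m : ℕ) (P : A) :
    ∃ B, (δ.toLinearMap ^ m) (P * E ^ m) = m.factorial * P * δ E ^ m + E * B := by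
  induction m generalizing P with
  | zero => exact ⟨0, by simp⟩
  | succ m ih =>
    -- The cofactor of `E^m` in `δ (P * E^(m+1))`.
    obtain ⟨B, hB⟩ := ih (δ P * E + (m + 1) * P * δ E)
    refine ⟨m.factorial * δ P * δ E ^ m + B, ?_⟩
    have h : δ (P * E ^ (m + 1)) = (δ P * E + (m + 1) * P * δ E) * E ^ m := by
      rw [δ.leibniz, δ.leibniz_pow]
      simp only [smul_eq_mul, nsmul_eq_mul, Nat.cast_add, Nat.cast_one, Nat.add_sub_cancel]
      ring
    rw [pow_succ, Module.End.mul_apply, Derivation.coeFn_coe, h, hB, Nat.factorial_succ]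
    push_cast
    ring

theorem pow_apply_mul_pow_char (p : ℕ) [CharP A p] (m : ℕ) (g h : A) :
    (δ.toLinearMap ^ m) (g * h ^ p) = (δ.toLinearMap ^ m) g * h ^ p := by
  induction m generalizing g with
  | zero => simp
  | succ m ih =>
    have : δ (g * h ^ p) = δ g * h ^ p := by
      rw [δ.leibniz, δ.leibniz_pow]
      simp [mul_comm]
    rw [pow_succ, Module.End.mul_apply, Module.End.mul_apply, Derivation.coeFn_coe, this, ih]

end Derivation

/-! ### Degree bounds and Cartier sections of polynomials -/

namespace MvPolynomial

variable {τ : Type*} {p : ℕ} [Fact p.Prime]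

theorem pow_pderiv_monomial {R : Type*} [CommRing R] (i : τ) (m : ℕ) (u : τ →₀ ℕ) (c : R) :
    ((pderiv i).toLinearMap ^ m) (monomial u c) =
      monomial (u - Finsupp.single i m) (c * (u i).descFactorial m) := by
  induction m generalizing u c with
  | zero => simp
  | succ m ih =>
    rw [pow_succ, Module.End.mul_apply, Derivation.coeFn_coe, pderiv_monomial, ih, tsub_tsub,
      ← Finsupp.single_add, add_comm 1 m]
    congr 1
    cases hu : u i with
    | zero => simp [hu]
    | succ k =>
      rw [Finsupp.tsub_apply, Finsupp.single_eq_same, hu, Nat.succ_descFactorial_succ,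
        Nat.add_sub_cancel, Nat.cast_mul, mul_assoc]

theorem add_single_mem_support_of_mem_support_pderiv {R : Type*} [CommRing R] {i : τ}
    {P : MvPolynomial τ R} {u : τ →₀ ℕ} (hu : u ∈ (pderiv i P).support) :
    u + Finsupp.single i 1 ∈ P.support := by
  classical
  rw [P.as_sum, map_sum] at hu
  obtain ⟨v, hv, huv⟩ := Finset.mem_biUnion.mp (support_sum hu)
  rw [pderiv_monomial] at huv
  have h1 := Finset.mem_singleton.mp (support_monomial_subset huv)
  have h2 : v i ≠ 0 := by
    rintro h
    rw [h] at huv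
    simp at huv
  rw [h1, tsub_add_cancel_of_le]
  · exact hv
  · rw [Finsupp.single_le_iff]; omega

/-- Every exponent of `P` has weight at most `b`. -/
def IsWeightBounded {R : Type*} [CommSemiring R] (w : (τ →₀ ℕ) →+ ℕ) (b : ℕ)
    (P : MvPolynomial τ R) : Prop :=
  ∀ u ∈ P.support, w u ≤ b

namespace IsWeightBounded

variable {R : Type*} [CommRing R] {w : (τ →₀ ℕ) →+ ℕ} {b c : ℕ} {P Q : MvPolynomial τ R}

theorem mul (hP : IsWeightBounded w b P) (hQ : IsWeightBounded w c Q) :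
    IsWeightBounded w (b + c) (P * Q) := by
  classical
  intro u hu
  obtain ⟨x, hx, y, hy, rfl⟩ := Finset.mem_add.mp (support_mul P Q hu)
  rw [map_add]
  exact add_le_add (hP x hx) (hQ y hy)

theorem pow (hP : IsWeightBounded w b P) (m : ℕ) : IsWeightBounded w (m * b) (P ^ m) := by
  induction m with
  | zero =>
    intro u hu
    rw [pow_zero, ← C_1, C_apply] at hu
    have := Finset.mem_singleton.mp (support_monomial_subset hu)
    simp [this]
  | succ m ih =>
    rw [pow_succ, Nat.succ_mul]
    exact ih.mul hP

theorem pderiv (hP : IsWeightBounded w b P) (i : τ) : IsWeightBounded w b (pderiv i P) :=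
  fun u hu => le_trans (by rw [map_add]; exact Nat.le_add_right _ _)
    (hP _ (add_single_mem_support_of_mem_support_pderiv hu))

theorem X_mul_pderiv (hP : IsWeightBounded w b P) (i : τ) :
    IsWeightBounded w b (X i * MvPolynomial.pderiv i P) := by
  classical
  intro u hu
  rw [support_X_mul] at hu
  obtain ⟨v, hv, rfl⟩ := Finset.mem_map.mp hu
  have := hP _ (add_single_mem_support_of_mem_support_pderiv hv)
  rwa [add_comm] at this

end IsWeightBounded

/-- The part of `P` with exponents congruent to `r` modulo `p`, divided by `X^r` and with its
`p`-th root extracted. -/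
def cartierSection (P : MvPolynomial τ (ZMod p)) (r : τ → Fin p) : MvPolynomial τ (ZMod p) :=
  open Classical in
  ∑ u ∈ P.support with digitOf p u = r, monomial (quotientExponent p u) (coeff u P)

theorem mem_support_of_mem_support_cartierSection [Finite τ] {P : MvPolynomial τ (ZMod p)}
    {r : τ → Fin p} {v : τ →₀ ℕ} (hv : v ∈ (cartierSection P r).support) :
    digitExponent r + p • v ∈ P.support := by
  classical
  obtain ⟨u, hu, huv⟩ := Finset.mem_biUnion.mp (support_sum hv)
  obtain ⟨-, rfl⟩ := Finset.mem_filter.mp hu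
  rw [Finset.mem_singleton.mp (support_monomial_subset huv), digitExponent_digitOf_add]
  exact Finset.mem_of_mem_filter _ hu

theorem sum_cartierSection [Fintype τ] [DecidableEq τ] (P : MvPolynomial τ (ZMod p)) :
    ∑ r : τ → Fin p, monomial (digitExponent r) 1 * cartierSection P r ^ p = P := by
  classical
  conv_rhs => rw [P.as_sum]
  rw [← Finset.sum_fiberwise_of_maps_to (s := P.support) (t := Finset.univ) (g := digitOf p)
    (fun _ _ => Finset.mem_univ _)]
  refine Finset.sum_congr rfl fun r _ => ?_
  rw [cartierSection, sum_pow_char, Finset.mul_sum]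
  refine Finset.sum_congr (by congr) fun u hu => ?_
  obtain ⟨-, rfl⟩ := Finset.mem_filter.mp hu
  rw [monomial_pow, ZMod.pow_card, monomial_mul, one_mul, digitExponent_digitOf_add]

/-- An exponent `v` of the section comes from an exponent `r + p v` of `P`, of weight at least `p`
times that of `v`. -/
theorem IsWeightBounded.cartierSection [Finite τ] {w : (τ →₀ ℕ) →+ ℕ} {b : ℕ}
    {P : MvPolynomial τ (ZMod p)} (hP : IsWeightBounded w (p * b) P) (r : τ → Fin p) :
    IsWeightBounded w b (cartierSection P r) := by
  intro v hv
  have h := hP _ (mem_support_of_mem_support_cartierSection hv)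
  rw [map_add, map_nsmul, smul_eq_mul] at h
  exact Nat.le_of_mul_le_mul_left (le_trans (Nat.le_add_left _ _) h)
    (Fact.out : p.Prime).pos

/-! ### Substituting an algebraic series for `y` -/

section evalSeries

variable {σ : Type*}

/-- The substitution `P(t, y) ↦ P(t, f)`, where `y` is the variable `none`. -/
def evalSeries {k : Type*} [CommRing k] (f : MvPowerSeries σ k) :
    MvPolynomial (Option σ) k →ₐ[k] MvPowerSeries σ k :=
  aeval fun o => o.elim f MvPowerSeries.X

theorem evalSeries_monomial [Fintype σ] {k : Type*} [CommRing k] (f : MvPowerSeries σ k)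
    (u : Option σ →₀ ℕ) (c : k) :
    evalSeries f (monomial u c) = MvPowerSeries.monomial u.some c * f ^ u none := by
  rw [evalSeries, aeval_monomial, Finsupp.prod_option_index, MvPowerSeries.monomial_eq',
    mul_assoc, mul_comm _ (f ^ _), MvPowerSeries.algebraMap_apply]
  · rfl
  · simp
  · intros; rw [pow_add]

theorem eq_zero_of_evalSeries_eq_zero [Fintype σ] {k : Type*} [CommRing k] {f : MvPowerSeries σ k}
    {P : MvPolynomial (Option σ) k} (hP : ∀ u ∈ P.support, u none = 0)
    (h : evalSeries f P = 0) : P = 0 := by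
  classical
  by_contra h0
  obtain ⟨u, hu⟩ := support_nonempty.mpr h0
  have h1 := congrArg (MvPowerSeries.coeff u.some) h
  rw [P.as_sum, map_sum, map_sum, Finset.sum_eq_single_of_mem u hu] at h1
  · rw [evalSeries_monomial, hP u hu, pow_zero, mul_one, MvPowerSeries.coeff_monomial_same] at h1
    exact mem_support_iff.mp hu h1
  · intro v hv hvu
    rw [evalSeries_monomial, hP v hv, pow_zero, mul_one, MvPowerSeries.coeff_monomial_ne]
    intro he
    refine hvu (Finsupp.ext fun o => ?_)
    cases o with
    | none => rw [hP u hu, hP v hv]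
    | some i => exact (DFunLike.congr_fun he i).symm

theorem dvd_of_pderiv_eq_zero {E : MvPolynomial (Option σ) (ZMod p)} (h : pderiv none E = 0)
    {u : Option σ →₀ ℕ} (hu : u ∈ E.support) : p ∣ u none := by
  by_contra hd
  have h0 : u none ≠ 0 := fun h => hd (h ▸ dvd_zero p)
  have h1 := congrArg (coeff (u - Finsupp.single none 1)) h
  have e : u - Finsupp.single none 1 + Finsupp.single none 1 = u :=
    tsub_add_cancel_of_le (Finsupp.single_le_iff.mpr (Nat.one_le_iff_ne_zero.mpr h0))
  rw [coeff_pderiv, e, coeff_zero, Finsupp.tsub_apply, Finsupp.single_eq_same] at h1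
  rcases mul_eq_zero.mp h1 with h2 | h2
  · exact mem_support_iff.mp hu h2
  · rw [← Nat.cast_add_one, Nat.sub_add_cancel (Nat.one_le_iff_ne_zero.mpr h0)] at h2
    exact hd ((ZMod.natCast_eq_zero_iff _ _).mp h2)

variable [Fintype σ] [DecidableEq σ]

/-- The digits of an exponent of `(t, y)` from those of `t` and that of `y`. -/
def consDigit {q : ℕ} (a : Fin q) (ρ : σ → Fin q) : Option σ → Fin q := fun o => o.elim a ρ

theorem sum_option_digits {M : Type*} [AddCommMonoid M] {q : ℕ} (a : Fin q)
    (F : (Option σ → Fin q) → M) (hF : ∀ r, r none ≠ a → F r = 0) :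
    ∑ r, F r = ∑ ρ, F (consDigit a ρ) := by
  refine (Finset.sum_of_injOn (ι := σ → Fin q) (consDigit a) ?_ (fun _ _ => Finset.mem_coe.mpr (Finset.mem_univ _))
    ?_ fun _ _ => rfl).symm
  · intro (ρ : σ → Fin q) _ (ρ' : σ → Fin q) _ h
    funext i
    exact congrFun h (some i)
  · intro r _ hr
    refine hF r fun h => hr ⟨fun i => r (some i), by simp, ?_⟩
    funext o
    cases o with
    | none => exact h.symm
    | some i => rfl

/-- At `y = f` the derivative `∂_y^(p-1)(P E^(p-1))` equals `(p-1)! P E_y^(p-1)`, because `E`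
vanishes there. On the digit expansion of `P E^(p-1)`, the `p`-th powers are constants, `y`-digits
below `p - 1` are killed, and the digit `p - 1` contributes `(p-1)!`. Both factorials are `-1`. -/
theorem evalSeries_mul_pow_pderiv {f : MvPowerSeries σ (ZMod p)}
    {E : MvPolynomial (Option σ) (ZMod p)} (hE : evalSeries f E = 0)
    (P : MvPolynomial (Option σ) (ZMod p)) :
    evalSeries f P * evalSeries f (pderiv none E) ^ (p - 1) =
      ∑ ρ : σ → Fin p, MvPowerSeries.monomial (digitExponent ρ) 1 *
        evalSeries f (cartierSection (P * E ^ (p - 1)) (consDigit (Fin.ofNat p (p - 1)) ρ)) ^ p := by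
  have hp : 1 < p := (Fact.out : p.Prime).one_lt
  have hlast : ((Fin.ofNat p (p - 1) : Fin p) : ℕ) = p - 1 :=
    Nat.mod_eq_of_lt (Nat.sub_lt (by omega) one_pos)
  have hfac : ((p - 1).factorial : ZMod p) = -1 := ZMod.wilsons_lemma p
  obtain ⟨B, hB⟩ := (pderiv (R := ZMod p) (none : Option σ)).exists_pow_apply_mul_pow E (p - 1) P
  have hL := congrArg (evalSeries f) hB
  rw [map_add, map_mul (evalSeries f) E, hE, zero_mul, add_zero, map_mul (evalSeries f),
    map_mul (evalSeries f), map_pow (evalSeries f), map_natCast (evalSeries f)] at hL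
  have hL' : evalSeries f P * evalSeries f (pderiv none E) ^ (p - 1) =
      - evalSeries f (((pderiv none).toLinearMap ^ (p - 1)) (P * E ^ (p - 1))) := by
    rw [hL, ← map_natCast (MvPowerSeries.C (σ := σ) (R := ZMod p)), hfac]
    simp
  rw [hL']
  conv_lhs => rw [← sum_cartierSection (P * E ^ (p - 1))]
  rw [map_sum, map_sum, sum_option_digits (Fin.ofNat p (p - 1)), ← Finset.sum_neg_distrib]
  · refine Finset.sum_congr rfl fun ρ _ => ?_
    have h1 : (digitExponent (consDigit (Fin.ofNat p (p - 1)) ρ)) none = p - 1 := hlast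
    rw [Derivation.pow_apply_mul_pow_char, pow_pderiv_monomial, map_mul, map_pow, h1,
      Nat.descFactorial_self, hfac, one_mul, evalSeries_monomial, ← neg_mul]
    congr 1
    rw [Finsupp.tsub_apply, h1, Finsupp.single_eq_same, Nat.sub_self, pow_zero, mul_one, ← map_neg,
      neg_neg]
    congr 2
    ext i
    simp [consDigit]
  · intro r hr
    have h1 : (r none : ℕ) < p - 1 := by
      have h2 := (r none).2
      have h3 : (r none : ℕ) ≠ p - 1 := fun h => hr (Fin.ext (h.trans hlast.symm))
      omega
    rw [Derivation.pow_apply_mul_pow_char, pow_pderiv_monomial, digitExponent_apply,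
      Nat.descFactorial_eq_zero_iff_lt.mpr h1]
    simp

/-- The denominator is unchanged: absorb it as `D^p` inside the section and use `D^p g = D^(p-1)
P(t, f)`. -/
theorem pderiv_mul_cartierSection {f : MvPowerSeries σ (ZMod p)}
    {E : MvPolynomial (Option σ) (ZMod p)} (hE : evalSeries f E = 0)
    {P : MvPolynomial (Option σ) (ZMod p)} {g : MvPowerSeries σ (ZMod p)}
    (hg : evalSeries f (pderiv none E) * g = evalSeries f P) (ρ : σ → Fin p) :
    evalSeries f (pderiv none E) * MvPowerSeries.cartierSection g ρ =
      evalSeries f (cartierSection (P * E ^ (p - 1)) (consDigit (Fin.ofNat p (p - 1)) ρ)) := by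
  rw [← MvPowerSeries.cartierSection_pow_mul, ← pow_sub_one_mul (Fact.out : p.Prime).ne_zero,
    mul_assoc, hg, mul_comm, evalSeries_mul_pow_pderiv hE, MvPowerSeries.cartierSection_sum]

/-- An algebraic series over `𝔽ₚ` is a simple root of an annihilating polynomial of minimal degree
in `y`; weight bounds are preserved. -/
theorem exists_simple_annihilator {ι : Type*} (w : ι → (Option σ →₀ ℕ) →+ ℕ) (b : ι → ℕ)
    {f : MvPowerSeries σ (ZMod p)} {E : MvPolynomial (Option σ) (ZMod p)} (hE0 : E ≠ 0)
    (hE : evalSeries f E = 0) (hb : ∀ a, IsWeightBounded (w a) (b a) E) :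
    ∃ E' : MvPolynomial (Option σ) (ZMod p), evalSeries f E' = 0 ∧
      evalSeries f (pderiv none E') ≠ 0 ∧ ∀ a, IsWeightBounded (w a) (b a) E' := by
  have hp : 1 < p := (Fact.out : p.Prime).one_lt
  obtain ⟨m, hm⟩ : ∃ m, ∀ u ∈ E.support, u none ≤ m :=
    ⟨E.support.sup fun u => u none, fun u hu => Finset.le_sup (f := fun u => u none) hu⟩
  induction m using Nat.strong_induction_on generalizing E with
  | _ m ih =>
    by_cases hD : evalSeries f (pderiv none E) = 0
    swap
    · exact ⟨E, hE, hD, hb⟩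
    -- A nonzero polynomial free of `y` cannot vanish at `f`.
    have hm0 : m ≠ 0 := by
      rintro rfl
      exact hE0 (eq_zero_of_evalSeries_eq_zero (fun u hu => Nat.le_zero.mp (hm u hu)) hE)
    by_cases hd : pderiv none E = 0
    -- Here `E` is a polynomial in `y^p`, so only sections of `y`-digit `0` occur. By uniqueness of
    -- sections of the series `0 = E(t, f)`, each of them annihilates `f`. Some section is nonzero,
    -- and its `y`-degree is at most `m / p`.
    · have hz : ∀ r : Option σ → Fin p, r none ≠ ⟨0, by omega⟩ → cartierSection E r = 0 := by
        intro r hr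
        rw [← support_eq_empty, Finset.eq_empty_iff_forall_notMem]
        intro v hv
        have h1 := dvd_of_pderiv_eq_zero hd (mem_support_of_mem_support_cartierSection hv)
        have h2 : p ∣ (r none : ℕ) := by
          simpa using (Nat.dvd_add_iff_left (dvd_mul_right p (v none))).mpr (by simpa using h1)
        exact hr (Fin.ext (Nat.eq_zero_of_dvd_of_lt h2 (r none).2))
      have hsum := congrArg (evalSeries f) (sum_cartierSection E)
      rw [hE, map_sum, sum_option_digits ⟨0, by omega⟩] at hsum
      swap
      · intro r hr
        rw [hz r hr, zero_pow (by omega), mul_zero, map_zero]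
      have hall : ∀ ρ : σ → Fin p, evalSeries f (cartierSection E (consDigit ⟨0, by omega⟩ ρ)) = 0 := by
        intro ρ
        have := MvPowerSeries.cartierSection_sum
          (fun ρ => evalSeries f (cartierSection E (consDigit ⟨0, by omega⟩ ρ))) ρ
        rw [← this]
        refine Eq.trans (congrArg (fun g => MvPowerSeries.cartierSection g ρ) (Eq.trans ?_ hsum))
          (by ext v; simp [MvPowerSeries.coeff_cartierSection])
        refine Finset.sum_congr rfl fun ρ' _ => ?_
        rw [map_mul, map_pow, evalSeries_monomial]
        have h0 : digitExponent (consDigit (⟨0, by omega⟩ : Fin p) ρ') none = 0 := rfl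
        have h1 : (digitExponent (consDigit (⟨0, by omega⟩ : Fin p) ρ')).some =
            digitExponent ρ' := by
          ext i
          rfl
        rw [h0, h1, pow_zero, mul_one]
      obtain ⟨ρ, hρ⟩ : ∃ ρ : σ → Fin p, cartierSection E (consDigit ⟨0, by omega⟩ ρ) ≠ 0 := by
        by_contra! hcon
        refine hE0 ?_
        rw [← sum_cartierSection E, sum_option_digits ⟨0, by omega⟩]
        · exact Finset.sum_eq_zero fun ρ _ => by rw [hcon, zero_pow (by omega), mul_zero]
        · intro r hr
          rw [hz r hr, zero_pow (by omega), mul_zero]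
      refine ih (m / p) (Nat.div_lt_self (by omega) hp) hρ (hall ρ) (fun a => ?_) fun v hv => ?_
      · refine IsWeightBounded.cartierSection (fun u hu => (hb a u hu).trans ?_) _
        exact Nat.le_mul_of_pos_left _ (by omega)
      · have := hm _ (mem_support_of_mem_support_cartierSection hv)
        rw [Nat.le_div_iff_mul_le (by omega), mul_comm]
        refine le_trans ?_ this
        simp
    -- A nonzero `∂_y E` that vanishes at `f` is itself an annihilator of smaller `y`-degree.
    · refine ih (m - 1) (by omega) hd hD (fun a => (hb a).pderiv none) fun u hu => ?_
      have := hm _ (add_single_mem_support_of_mem_support_pderiv hu)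
      simp only [Finsupp.add_apply, Finsupp.single_eq_same] at this
      omega

end evalSeries

end MvPolynomial


/-! ### Reduction of the annihilator modulo `p` -/

namespace MvPolynomial

theorem map_evalSeries {σ R S : Type*} [CommRing R] [CommRing S] (φ : R →+* S)
    (f : MvPowerSeries σ R) (P : MvPolynomial (Option σ) R) :
    MvPowerSeries.map φ (evalSeries f P) = evalSeries (MvPowerSeries.map φ f) (map φ P) := by
  induction P using MvPolynomial.induction_on with
  | C a =>
    rw [map_C, ← algebraMap_eq, ← algebraMap_eq, AlgHom.commutes, AlgHom.commutes,
      MvPowerSeries.algebraMap_apply, MvPowerSeries.algebraMap_apply]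
    simp
  | add P Q hP hQ => rw [map_add, map_add, hP, hQ, map_add, map_add]
  | mul_X P o hP =>
    rw [map_mul, map_mul, hP, map_mul, map_mul, map_X, evalSeries, aeval_X, evalSeries, aeval_X]
    cases o <;> simp

theorem evalSeries_eq_aeval_optionEquivLeft {σ k : Type*} [CommRing k] (f : MvPowerSeries σ k)
    (P : MvPolynomial (Option σ) k) :
    evalSeries f P = Polynomial.aeval f (optionEquivLeft k σ P) := by
  have h : evalSeries f = ((Polynomial.aeval f).restrictScalars k).comp
      (optionEquivLeft k σ).toAlgHom := by
    refine algHom_ext fun o => ?_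
    cases o with
    | none => simp [evalSeries]
    | some i => simp [evalSeries, MvPowerSeries.algebraMap_apply']
  exact DFunLike.congr_fun h P

/-- A polynomial over `ℚ` annihilating the integral series `f` gives, after clearing denominators
and removing the content at `p`, a nonzero annihilator of `f` modulo `p` with no new exponents. -/
theorem exists_annihilator_mod_prime {σ : Type*} [Finite σ] (p : ℕ) [Fact p.Prime]
    (f : MvPowerSeries σ ℤ) {E : MvPolynomial (Option σ) ℚ} (hE0 : E ≠ 0)
    (hE : evalSeries (MvPowerSeries.map (Int.castRingHom ℚ) f) E = 0) :
    ∃ E' : MvPolynomial (Option σ) (ZMod p), E' ≠ 0 ∧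
      evalSeries (MvPowerSeries.map (Int.castRingHom (ZMod p)) f) E' = 0 ∧
      E'.support ⊆ E.support := by
  have hp : p.Prime := Fact.out
  let _ : Algebra (MvPolynomial (Option σ) ℤ) (MvPolynomial (Option σ) ℚ) := algebraMvPolynomial
  obtain ⟨⟨Z, m, hm⟩, hZ⟩ := IsLocalization.surj
    ((nonZeroDivisors ℤ).map (C (σ := Option σ))) E
  obtain ⟨m, hm0, rfl⟩ := hm
  have hm0 : m ≠ 0 := nonZeroDivisors.ne_zero hm0
  have hZ : E * C (m : ℚ) = map (Int.castRingHom ℚ) Z := by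
    have hZ' : E * map (Int.castRingHom ℚ) (C m) = map (Int.castRingHom ℚ) Z := hZ
    rwa [map_C] at hZ'
  have hmQ : (m : ℚ) ≠ 0 := Int.cast_ne_zero.mpr hm0
  have hZ0 : Z ≠ 0 := by
    rintro rfl
    rw [map_zero] at hZ
    rcases mul_eq_zero.mp hZ with h | h
    · exact hE0 h
    · exact hmQ (C_eq_zero.mp h)
  have hnu : ¬ IsUnit (C (p : ℤ) : MvPolynomial (Option σ) ℤ) := by
    intro h
    rw [isUnit_iff_eq_C_of_isReduced] at h
    obtain ⟨r, hr, hr'⟩ := h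
    rw [← C_injective _ _ hr', Int.isUnit_iff] at hr
    have := hp.two_le
    rcases hr with h | h <;> omega
  -- Removing the exact power of `p` is what keeps the reduction nonzero.
  obtain ⟨a, Y, hY, hYd⟩ : ∃ a Y, Z = C (p : ℤ) ^ a * Y ∧ ¬ C (p : ℤ) ∣ Y :=
    ⟨_, (FiniteMultiplicity.of_not_isUnit hnu hZ0).exists_eq_pow_mul_and_not_dvd⟩
  have hYZ : ∀ u, coeff u Z = (p : ℤ) ^ a * coeff u Y := fun u => by
    rw [hY, ← C_pow, coeff_C_mul]
  refine ⟨map (Int.castRingHom (ZMod p)) Y, fun h => hYd ((C_dvd_iff_zmod p Y).mpr h), ?_, ?_⟩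
  · have h1 : evalSeries (MvPowerSeries.map (Int.castRingHom ℚ) f)
        (map (Int.castRingHom ℚ) Z) = 0 := by
      rw [← hZ, map_mul, hE, zero_mul]
    rw [← map_evalSeries] at h1
    have h2 : evalSeries f Z = 0 := by
      ext u
      have := congrArg (MvPowerSeries.coeff u) h1
      simpa using this
    have h3 : evalSeries f Y = 0 := by
      rw [hY, map_mul, map_pow, ← algebraMap_eq, AlgHom.commutes,
        MvPowerSeries.algebraMap_apply, ← map_pow] at h2
      ext u
      have := congrArg (MvPowerSeries.coeff u) h2
      rw [MvPowerSeries.coeff_C_mul] at this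
      have hpa : ((p : ℤ) ^ a) ≠ 0 := pow_ne_zero _ (Int.natCast_ne_zero.mpr hp.ne_zero)
      simpa [hpa] using this
    rw [← map_evalSeries, h3, map_zero]
  · intro u hu
    rw [mem_support_iff, coeff_map] at hu
    rw [mem_support_iff]
    intro h0
    have h1 := congrArg (coeff u) hZ
    rw [mul_comm, coeff_C_mul, h0, mul_zero, coeff_map, hYZ] at h1
    have hpa : ((p : ℤ) ^ a) ≠ 0 := pow_ne_zero _ (Int.natCast_ne_zero.mpr hp.ne_zero)
    have h2 : (p : ℤ) ^ a * coeff u Y = 0 := Int.cast_injective (α := ℚ) (by simpa using h1.symm)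
    rw [(mul_eq_zero.mp h2).resolve_left hpa] at hu
    simp at hu

end MvPolynomial

/-! ### Heights as bounds on exponents -/

namespace DiagModP

open MvPolynomial

/-- The minimal polynomial as a polynomial in the variables `some i = tᵢ` and `none = y`. -/
def flatMinimalPolynomial {n : ℕ} (f : MvPowerSeries (Fin n) ℚ) : MvPolynomial (Option (Fin n)) ℚ :=
  (optionEquivLeft ℚ (Fin n)).symm (minimalPolynomial f)

variable {n : ℕ} {f : MvPowerSeries (Fin n) ℚ}

theorem some_mem_support_coeff {u : Option (Fin n) →₀ ℕ}
    (hu : u ∈ (flatMinimalPolynomial f).support) :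
    u.some ∈ ((minimalPolynomial f).coeff (u none)).support := by
  rw [mem_support_iff, flatMinimalPolynomial, ← optionEquivLeft_coeff_some_coeff_none,
    AlgEquiv.apply_symm_apply] at hu
  rwa [mem_support_iff]

theorem none_mem_support {u : Option (Fin n) →₀ ℕ}
    (hu : u ∈ (flatMinimalPolynomial f).support) :
    u none ∈ (minimalPolynomial f).support := by
  rw [Polynomial.mem_support_iff]
  intro h
  have := some_mem_support_coeff hu
  simp [h] at this

theorem none_le_degree {u : Option (Fin n) →₀ ℕ}
    (hu : u ∈ (flatMinimalPolynomial f).support) : u none ≤ degree f :=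
  Polynomial.le_natDegree_of_mem_supp _ (none_mem_support hu)

theorem some_le_partialHeight {u : Option (Fin n) →₀ ℕ}
    (hu : u ∈ (flatMinimalPolynomial f).support) (i : Fin n) : u (some i) ≤ partialHeight f i :=
  (monomial_le_degreeOf i (some_mem_support_coeff hu)).trans
    (Finset.le_sup (f := fun j => ((minimalPolynomial f).coeff j).degreeOf i)
      (none_mem_support hu))

theorem sum_some_le_totalHeight {u : Option (Fin n) →₀ ℕ}
    (hu : u ∈ (flatMinimalPolynomial f).support) : ∑ i, u (some i) ≤ totalHeight f := by
  refine le_trans ?_ ((le_totalDegree (some_mem_support_coeff hu)).trans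
    (Finset.le_sup (f := fun j => ((minimalPolynomial f).coeff j).totalDegree)
      (none_mem_support hu)))
  rw [Finsupp.sum_fintype _ _ (by simp)]
  simp

theorem flatMinimalPolynomial_spec (hf : IsAlgebraic (MvPolynomial (Fin n) ℚ) f) :
    flatMinimalPolynomial f ≠ 0 ∧ evalSeries f (flatMinimalPolynomial f) = 0 := by
  have h := isMinimalPolynomial_minimalPolynomial hf
  refine ⟨fun h0 => h.ne_zero ?_, ?_⟩
  · rwa [flatMinimalPolynomial, EmbeddingLike.map_eq_zero_iff] at h0
  · rw [evalSeries_eq_aeval_optionEquivLeft, flatMinimalPolynomial, AlgEquiv.apply_symm_apply]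
    exact h.aeval_eq_zero

end DiagModP


/-! ### Counting exponents with a zero entry -/

namespace DiagModP

/-- The exponents in the box `∏ [0, hᵢ]` with at least one zero entry. -/
def boxExponents {n : ℕ} (hs : Fin n → ℕ) : Finset (Fin n →₀ ℕ) :=
  Finset.Iic (Finsupp.equivFunOnFinite.symm hs) \
    Finset.Icc (Finsupp.equivFunOnFinite.symm fun _ => 1) (Finsupp.equivFunOnFinite.symm hs)

theorem mem_boxExponents {n : ℕ} {hs : Fin n → ℕ} {u : Fin n →₀ ℕ} (h : ∀ i, u i ≤ hs i)
    (h0 : ∃ i, u i = 0) : u ∈ boxExponents hs := by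
  obtain ⟨i, hi⟩ := h0
  rw [boxExponents, Finset.mem_sdiff, Finset.mem_Iic, Finset.mem_Icc]
  refine ⟨h, fun hu => ?_⟩
  have := hu.1 i
  simp [hi] at this

theorem card_boxExponents {n : ℕ} (hs : Fin n → ℕ) :
    (boxExponents hs).card = ∏ i, (hs i + 1) - ∏ i, hs i := by
  rw [boxExponents, Finset.card_sdiff_of_subset, Finsupp.card_Iic, Finsupp.card_Icc]
  · congr 1
    · rw [Finset.prod_subset (Finset.subset_univ _)]
      · simp
      · intro i _ hi
        rw [Finsupp.notMem_support_iff] at hi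
        simp [hi]
    · rw [Finset.prod_subset (Finset.subset_univ _)]
      · simp
      · intro i _ hi
        simp at hi
  · intro u hu
    exact Finset.mem_Iic.mpr (Finset.mem_Icc.mp hu).2

/-- The exponents of total degree at most `h`. -/
def simplexExponents (n h : ℕ) : Finset (Fin n →₀ ℕ) :=
  (Finset.range (h + 1)).biUnion fun m => Finset.univ.finsuppAntidiag m

theorem mem_simplexExponents {n h : ℕ} {u : Fin n →₀ ℕ} :
    u ∈ simplexExponents n h ↔ ∑ i, u i ≤ h := by
  simp [simplexExponents, Finset.mem_finsuppAntidiag]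

theorem card_simplexExponents {n : ℕ} (hn : 1 ≤ n) (h : ℕ) :
    (simplexExponents n h).card = (n + h).choose n := by
  rw [simplexExponents, Finset.card_biUnion]
  · simp_rw [Finset.card_finsuppAntidiag_nat_eq_choose, Finset.card_univ, Fintype.card_fin]
    obtain ⟨m, rfl⟩ := Nat.exists_eq_add_of_le' hn
    induction h with
    | zero => simp
    | succ h ih =>
      rw [Finset.sum_range_succ, ih]
      have h1 : m + 1 + (h + 1) - 1 = m + (h + 1) := by omega
      have h2 : m + 1 + (h + 1) = (m + (h + 1)) + 1 := by omega
      have h3 : m + 1 + h = m + (h + 1) := by omega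
      rw [h1, h2, h3, Nat.choose_succ_succ, Nat.choose_symm_add, add_comm]
  · intro a _ b _ hab
    rw [Function.onFun, Finset.disjoint_left]
    intro u hu hu'
    rw [Finset.mem_finsuppAntidiag] at hu hu'
    exact hab (hu.1.symm.trans hu'.1)

/-- The exponents of total degree at most `h` with at least one zero entry. -/
def simplexFaceExponents (n h : ℕ) : Finset (Fin n →₀ ℕ) :=
  (simplexExponents n h).filter fun u => ∃ i, u i = 0

theorem card_simplexFaceExponents_le {n : ℕ} (hn : 1 ≤ n) (h : ℕ) :
    (simplexFaceExponents n h).card ≤ (n + h).choose n - h.choose n := by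
  have hsum := Finset.card_filter_add_card_filter_not (s := simplexExponents n h)
    (fun u => ∃ i, u i = 0)
  rw [card_simplexExponents hn] at hsum
  -- Adding `(1, …, 1)` embeds the simplex of size `h - n` into the exponents without zero entry;
  -- for `h < n` the binomial coefficient is `0`.
  have hle : h.choose n ≤ ((simplexExponents n h).filter fun u => ¬ ∃ i, u i = 0).card := by
    by_cases hnh : n ≤ h
    · have h1 := card_simplexExponents hn (h - n)
      rw [Nat.add_sub_cancel' hnh] at h1
      rw [← h1]
      refine Finset.card_le_card_of_injOn
        (fun u => u + Finsupp.equivFunOnFinite.symm fun _ => 1) ?_ (add_left_injective _).injOn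
      intro u hu
      have hu' := mem_simplexExponents.mp hu
      simp [mem_simplexExponents, Finset.sum_add_distrib]
      omega
    · rw [Nat.choose_eq_zero_of_lt (by omega)]
      exact Nat.zero_le _
  rw [simplexFaceExponents]
  omega

theorem bound_ne_zero {n : ℕ} (hn : 1 ≤ n) (d h : ℕ) (hs : Fin n → ℕ) : bound d h hs ≠ 0 := by
  have h1 : 0 < ∏ i, (hs i + 1) - ∏ i, hs i := by
    rw [← card_boxExponents, Finset.card_pos]
    exact ⟨0, mem_boxExponents (by simp) ⟨⟨0, hn⟩, rfl⟩⟩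
  have h2 : 0 < (n + h).choose n - h.choose n := by
    refine lt_of_lt_of_le (Finset.card_pos.mpr ⟨0, ?_⟩) (card_simplexFaceExponents_le hn h)
    exact Finset.mem_filter.mpr ⟨mem_simplexExponents.mpr (by simp), ⟨0, hn⟩, rfl⟩
  exact Nat.mul_ne_zero (Nat.succ_ne_zero d) (lt_min h1 h2).ne'

end DiagModP


/-! ### The space of diagonals and its dimension -/

namespace DiagModP

open MvPolynomial

variable {n : ℕ} {p : ℕ} [Fact p.Prime]

/-- `k⟦t₁, …, tₙ⟧` as a `k[T]`-algebra, with `T` acting as `t₁ ⋯ tₙ`. -/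
abbrev prodAlgebra (n : ℕ) (k : Type*) [CommRing k] :
    Algebra (Polynomial k) (MvPowerSeries (Fin n) k) :=
  (Polynomial.aeval (∏ i, MvPowerSeries.X i : MvPowerSeries (Fin n) k)).toRingHom.toAlgebra

/-- The monomials `t^v f^j` with `v ∈ C` and `j ≤ d`. -/
def monomialFamily {k : Type*} [CommRing k] (f : MvPowerSeries (Fin n) k) (d : ℕ)
    (C : Finset (Fin n →₀ ℕ)) : Finset (MvPowerSeries (Fin n) k) :=
  open Classical in
  (Finset.range (d + 1) ×ˢ C).image fun x => MvPowerSeries.monomial x.2 1 * f ^ x.1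

theorem card_monomialFamily_le {k : Type*} [CommRing k] (f : MvPowerSeries (Fin n) k) (d : ℕ)
    (C : Finset (Fin n →₀ ℕ)) : (monomialFamily f d C).card ≤ (d + 1) * C.card := by
  classical
  exact Finset.card_image_le.trans (by simp)

theorem prod_X_mul_monomial {k : Type*} [CommRing k] (v : Fin n →₀ ℕ) (c : k) :
    (∏ i, MvPowerSeries.X i) * MvPowerSeries.monomial v c =
      MvPowerSeries.monomial ((Finsupp.equivFunOnFinite.symm fun _ => 1) + v) c := by
  have hT : (∏ i, MvPowerSeries.X i : MvPowerSeries (Fin n) k) =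
      MvPowerSeries.monomial (Finsupp.equivFunOnFinite.symm fun _ => 1) 1 := by
    rw [MvPowerSeries.monomial_eq', Finsupp.prod_fintype _ _ (by simp)]
    simp
  rw [hT, MvPowerSeries.monomial_mul_monomial, one_mul]

/-- A monomial without zero entry is divisible by `t₁⋯tₙ`, which acts as the scalar `T`. Stripping
this factor does not increase any weight, the weights being additive with values in `ℕ`, and the
process stops once an entry is zero. The induction is on the exponent of the first variable. -/
theorem evalSeries_mem_span_monomialFamily [NeZero n] {k : Type*} [CommRing k]
    (f : MvPowerSeries (Fin n) k) {ι : Type*} (w : ι → (Option (Fin n) →₀ ℕ) →+ ℕ) (b : ι → ℕ)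
    {d : ℕ} {C : Finset (Fin n →₀ ℕ)}
    (hC : ∀ u : Option (Fin n) →₀ ℕ, (∀ a, w a u ≤ b a) →
      u none ≤ d ∧ ((∃ i, u (some i) = 0) → u.some ∈ C))
    {P : MvPolynomial (Option (Fin n)) k} (hP : ∀ a, IsWeightBounded (w a) (b a) P) :
    letI := prodAlgebra n k
    evalSeries f P ∈ Submodule.span (Polynomial k)
      (monomialFamily f d C : Set (MvPowerSeries (Fin n) k)) := by
  classical
  let _ := prodAlgebra n k
  have key : ∀ (m : ℕ) (u : Option (Fin n) →₀ ℕ), u (some 0) = m → (∀ a, w a u ≤ b a) →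
      MvPowerSeries.monomial u.some (1 : k) * f ^ u none ∈ Submodule.span (Polynomial k)
        (monomialFamily f d C : Set (MvPowerSeries (Fin n) k)) := by
    intro m
    induction m with
    | zero =>
      intro u hu0 hu
      obtain ⟨h1, h2⟩ := hC u hu
      refine Submodule.subset_span (Finset.mem_coe.mpr (Finset.mem_image.mpr
        ⟨(u none, u.some), Finset.mem_product.mpr ⟨?_, h2 ⟨0, hu0⟩⟩, rfl⟩))
      exact Finset.mem_range.mpr (Nat.lt_succ_of_le h1)
    | succ m ih =>
      intro u hu0 hu
      by_cases hz : ∃ i, u (some i) = 0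
      · obtain ⟨h1, h2⟩ := hC u hu
        refine Submodule.subset_span (Finset.mem_coe.mpr (Finset.mem_image.mpr
          ⟨(u none, u.some), Finset.mem_product.mpr ⟨?_, h2 hz⟩, rfl⟩))
        exact Finset.mem_range.mpr (Nat.lt_succ_of_le h1)
      · push Not at hz
        let e : Option (Fin n) →₀ ℕ := Finsupp.equivFunOnFinite.symm fun o => o.elim 0 fun _ => 1
        have hle : e ≤ u := by
          intro o
          cases o with
          | none => exact Nat.zero_le _
          | some i => exact Nat.one_le_iff_ne_zero.mpr (hz i)
        obtain ⟨v, rfl⟩ := exists_add_of_le hle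
        have hv0 : v (some 0) = m := by
          have : 1 + v (some 0) = m + 1 := hu0
          omega
        have hv := ih v hv0 fun a => le_trans (by rw [map_add]; exact Nat.le_add_left _ _) (hu a)
        have hT := Submodule.smul_mem _ (Polynomial.X : Polynomial k) hv
        have h1 : (e + v) none = v none := by
          change 0 + v none = v none
          omega
        have h2 : (e + v).some = (Finsupp.equivFunOnFinite.symm fun _ => 1) + v.some := by
          ext i
          rfl
        rw [h1, h2, ← prod_X_mul_monomial, mul_assoc]
        have h3 : ∀ g : MvPowerSeries (Fin n) k,
            (Polynomial.X : Polynomial k) • g = (∏ i, MvPowerSeries.X i) * g := by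
          intro g
          change Polynomial.aeval (∏ i, MvPowerSeries.X i : MvPowerSeries (Fin n) k)
            (Polynomial.X : Polynomial k) * g = _
          rw [Polynomial.aeval_X]
        rwa [h3] at hT
  rw [P.as_sum, map_sum]
  refine Submodule.sum_mem _ fun u hu => ?_
  have hmem := Submodule.smul_mem _ (Polynomial.C (coeff u P)) (key _ u rfl fun a => hP a u hu)
  have h3 : ∀ (c : k) (g : MvPowerSeries (Fin n) k),
      Polynomial.C c • g = MvPowerSeries.C c * g := by
    intro c g
    change Polynomial.aeval (∏ i, MvPowerSeries.X i : MvPowerSeries (Fin n) k)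
      (Polynomial.C c) * g = _
    rw [Polynomial.aeval_C, MvPowerSeries.algebraMap_apply]
    rfl
  rw [h3, ← mul_assoc, ← MvPowerSeries.smul_eq_C_mul, ← map_smul, smul_eq_mul, mul_one] at hmem
  rwa [evalSeries_monomial]

theorem algebraMap_polynomial_laurentSeries {k : Type*} [Field k] (c : Polynomial k) :
    algebraMap (Polynomial k) (LaurentSeries k) c = HahnSeries.ofPowerSeries ℤ k c := by
  rw [IsScalarTower.algebraMap_apply (Polynomial k) (RatFunc k) (LaurentSeries k)]
  exact (RatFunc.coe_coe c).symm

/-- The diagonal as a `k[T]`-linear map to `k((T))`. -/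
def diagonalLaurent (n : ℕ) [NeZero n] (k : Type*) [Field k] :
    letI := prodAlgebra n k
    MvPowerSeries (Fin n) k →ₗ[Polynomial k] LaurentSeries k :=
  letI := prodAlgebra n k
  { toFun := fun g => HahnSeries.ofPowerSeries ℤ k (diagonal g)
    map_add' := fun g g' => by
      rw [← diagonalHom_apply, map_add, map_add]; rfl
    map_smul' := fun c g => by
      change HahnSeries.ofPowerSeries ℤ k (diagonal (Polynomial.aeval _ c * g)) = c • _
      rw [diagonal_aeval_mul, map_mul, Algebra.smul_def, algebraMap_polynomial_laurentSeries] }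

/-- The weights are kept abstract so that partial degrees and total degree are handled by one
argument. -/
theorem exists_isLinearized_diagonal [NeZero n] {f : MvPowerSeries (Fin n) (ZMod p)} {ι : Type*}
    (w : ι → (Option (Fin n) →₀ ℕ) →+ ℕ) (b : ι → ℕ) {d : ℕ} {C : Finset (Fin n →₀ ℕ)}
    (hC : ∀ u : Option (Fin n) →₀ ℕ, (∀ a, w a u ≤ b a) →
      u none ≤ d ∧ ((∃ i, u (some i) = 0) → u.some ∈ C))
    {E : MvPolynomial (Option (Fin n)) (ZMod p)} (hE0 : E ≠ 0) (hE : evalSeries f E = 0)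
    (hEb : ∀ a, IsWeightBounded (w a) (b a) E) {N : ℕ} (hN : (d + 1) * C.card ≤ N) :
    ∃ M ≤ N, ∃ P : Polynomial (RatFunc (ZMod p)), IsLinearized p M P ∧
      Polynomial.aeval (HahnSeries.ofPowerSeries ℤ (ZMod p) (diagonal f)) P = 0 := by
  classical
  have hp : p.Prime := Fact.out
  obtain ⟨E, hE, hD, hEb⟩ := exists_simple_annihilator w b hE0 hE hEb
  let _ := prodAlgebra n (ZMod p)
  have hdom : IsDomain (MvPowerSeries (Fin n) (ZMod p)) := NoZeroDivisors.to_isDomain _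
  let φ := diagonalLaurent n (ZMod p)
  let D := evalSeries f (pderiv none E)
  let G : Set (MvPowerSeries (Fin n) (ZMod p)) :=
    {g | ∃ P, (∀ a, IsWeightBounded (w a) (b a) P) ∧ D * g = evalSeries f P}
  let W : Submodule (RatFunc (ZMod p)) (LaurentSeries (ZMod p)) :=
    Submodule.span (RatFunc (ZMod p)) (φ '' G)
  obtain ⟨hfin, hrank⟩ := finrank_span_image_comap_le (K := RatFunc (ZMod p)) φ hD
    (monomialFamily f d C)
  have hle : W ≤ Submodule.span (RatFunc (ZMod p)) (φ '' {g | D * g ∈ Submodule.span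
      (Polynomial (ZMod p)) (monomialFamily f d C : Set (MvPowerSeries (Fin n) (ZMod p)))}) := by
    refine Submodule.span_mono (Set.image_mono ?_)
    rintro g ⟨P, hP, hg⟩
    rw [Set.mem_ofPred_eq, hg]
    exact evalSeries_mem_span_monomialFamily f w b hC hP
  have hWfin : FiniteDimensional (RatFunc (ZMod p)) W := Submodule.finiteDimensional_of_le hle
  have hWN : Module.finrank (RatFunc (ZMod p)) W ≤ N :=
    (Submodule.finrank_mono hle).trans (hrank.trans ((card_monomialFamily_le f d C).trans hN))
  have hchar : CharP (LaurentSeries (ZMod p)) p :=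
    charP_of_injective_algebraMap (algebraMap (ZMod p) (LaurentSeries (ZMod p))).injective p
  have hexp : ExpChar (LaurentSeries (ZMod p)) p := ExpChar.prime hp
  refine exists_isLinearized_of_le_span_pow p W hWN (Submodule.span_le.mpr ?_)
    -- The series `f` has numerator `y E_y`, which respects the bounds of `E`.
    (Submodule.subset_span ⟨f, ⟨X none * pderiv none E, fun a => (hEb a).X_mul_pderiv none, ?_⟩,
      rfl⟩)
  · rintro _ ⟨g, ⟨P, hP, hg⟩, rfl⟩
    have hsec : ∀ ρ : Fin n → Fin p, MvPowerSeries.cartierSection g ρ ∈ G := by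
      intro ρ
      refine ⟨_, fun a => IsWeightBounded.cartierSection ?_ _, pderiv_mul_cartierSection hE hg ρ⟩
      have h := (hP a).mul ((hEb a).pow (p - 1))
      -- The numerator `P E^(p-1)` has weight at most `p b`, which taking a section brings back to
      -- `b`.
      have hb : b a + (p - 1) * b a = p * b a := by
        obtain ⟨q, hq⟩ := Nat.exists_eq_add_of_le' hp.one_le
        rw [hq, Nat.add_sub_cancel]
        ring
      rwa [hb] at h
    choose c hc using fun ρ : Fin n → Fin p => exists_diagonal_monomial_mul_pow (n := n) ρ
    have hdiag : φ g = ∑ ρ : Fin n → Fin p, algebraMap (Polynomial (ZMod p)) (RatFunc (ZMod p))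
        (c ρ) • φ (MvPowerSeries.cartierSection g ρ) ^ p := by
      conv_lhs => rw [← MvPowerSeries.sum_cartierSection g]
      rw [map_sum]
      refine Finset.sum_congr rfl fun ρ _ => ?_
      change HahnSeries.ofPowerSeries ℤ (ZMod p) (diagonal _) = _
      rw [hc, map_mul, map_pow, algebraMap_smul, Algebra.smul_def,
        algebraMap_polynomial_laurentSeries]
      rfl
    rw [SetLike.mem_coe, hdiag]
    exact Submodule.sum_mem _ fun ρ _ => Submodule.smul_mem _ _ (Submodule.subset_span
      ⟨_, Submodule.subset_span ⟨_, hsec ρ, rfl⟩, rfl⟩)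
  · rw [map_mul, mul_comm]
    congr 1
    simp [evalSeries]

/-- The reduction modulo `p` of the diagonal of `f` is a root of a linearized polynomial of
`p`-degree at most `bound`. -/
theorem exists_isLinearized_diagonal_map (hn : 1 ≤ n) (f : MvPowerSeries (Fin n) ℤ)
    {fQ : MvPowerSeries (Fin n) ℚ} (hfQ : fQ = MvPowerSeries.map (Int.castRingHom ℚ) f)
    (hf : IsAlgebraic (MvPolynomial (Fin n) ℚ) fQ) :
    ∃ M ≤ bound (degree fQ) (totalHeight fQ) (partialHeight fQ),
      ∃ P : Polynomial (RatFunc (ZMod p)), IsLinearized p M P ∧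
        Polynomial.aeval (HahnSeries.ofPowerSeries ℤ (ZMod p)
          (diagonal (MvPowerSeries.map (Int.castRingHom (ZMod p)) f))) P = 0 := by
  have : NeZero n := ⟨by omega⟩
  obtain ⟨h0, hann⟩ := flatMinimalPolynomial_spec hf
  obtain ⟨E, hE0, hE, hsub⟩ := exists_annihilator_mod_prime p f h0 (hfQ ▸ hann)
  -- Whichever term attains the minimum dictates the weights: the degrees in `y` and in each `tᵢ`
  -- for the box, the degree in `y` and the total degree in `t` for the simplex.
  rcases min_choice (∏ i, (partialHeight fQ i + 1) - ∏ i, partialHeight fQ i)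
    ((n + totalHeight fQ).choose n - (totalHeight fQ).choose n) with hmin | hmin
  · refine exists_isLinearized_diagonal (ι := Option (Fin n)) (d := degree fQ)
      (C := boxExponents (partialHeight fQ)) (fun o => Finsupp.applyAddHom o)
      (fun o => o.elim (degree fQ) (partialHeight fQ)) (fun u hu => ⟨hu none, fun hz => ?_⟩)
      hE0 hE (fun o u hu => ?_) ?_
    · exact mem_boxExponents (fun i => hu (some i)) hz
    · cases o with
      | none => exact none_le_degree (hsub hu)
      | some i => exact some_le_partialHeight (hsub hu) i
    · rw [bound, hmin, card_boxExponents]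
  · refine exists_isLinearized_diagonal (ι := Option Unit) (d := degree fQ)
      (C := simplexFaceExponents n (totalHeight fQ))
      (fun o => o.elim (Finsupp.applyAddHom none) fun _ => ∑ i, Finsupp.applyAddHom (some i))
      (fun o => o.elim (degree fQ) fun _ => totalHeight fQ)
      (fun u hu => ⟨hu none, fun hz => ?_⟩) hE0 hE (fun o u hu => ?_) ?_
    · refine Finset.mem_filter.mpr ⟨mem_simplexExponents.mpr ?_, hz⟩
      simpa using hu (some ())
    · cases o with
      | none => exact none_le_degree (hsub hu)
      | some _ => simpa using sum_some_le_totalHeight (hsub hu)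
    · rw [bound, hmin]
      exact Nat.mul_le_mul_left _ (card_simplexFaceExponents_le hn _)

end DiagModP

end

/-- For `f ∈ ℤ⟦t₁,…,tₙ⟧` algebraic (over `ℚ(t)`), `x` is the reduction modulo `p` of the diagonal
of `f`, seen in the field `𝔽ₚ((t))`, an extension of `𝔽ₚ(t)`. -/
theorem theorem1p1 (n : ℕ) (hn : 1 ≤ n) (f : MvPowerSeries (Fin n) ℤ)
    (fQ : MvPowerSeries (Fin n) ℚ) (hfQ : fQ = MvPowerSeries.map (Int.castRingHom ℚ) f)
    (hf : IsAlgebraic (MvPolynomial (Fin n) ℚ) fQ)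
    (N : ℕ) (hN : N = DiagModP.bound (DiagModP.degree fQ) (DiagModP.totalHeight fQ)
      (DiagModP.partialHeight fQ))
    (p : ℕ) [Fact p.Prime] (x : LaurentSeries (ZMod p))
    (hx : x = HahnSeries.ofPowerSeries ℤ (ZMod p)
      (PowerSeries.map (Int.castRingHom (ZMod p)) (DiagModP.diagonal f))) :
    (∃ M ≤ N, ∃ P : Polynomial (RatFunc (ZMod p)),
      DiagModP.IsLinearized p M P ∧ Polynomial.aeval x P = 0) ∧
    IsAlgebraic (RatFunc (ZMod p)) x ∧
    (minpoly (RatFunc (ZMod p)) x).natDegree ≤ p ^ N - 1 := by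
  obtain ⟨M, hM, P, hP, hPx⟩ := DiagModP.exists_isLinearized_diagonal_map (p := p) hn f hfQ hf
  rw [← DiagModP.map_diagonal, ← hx] at hPx
  rw [← hN] at hM
  exact ⟨⟨M, hM, P, hP, hPx⟩, DiagModP.isAlgebraic_and_natDegree_minpoly_le Fact.out
    (hN ▸ DiagModP.bound_ne_zero hn _ _ _) hM hP hPx⟩
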